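/- A \emph{list $k$-assignment} of a finite simple graph $G=(V,E)$ is a map $L$ assigning to each vertex $v$ a set $L(v)$ of exactly $k$ positive integers; put $L_v=\{v\}\times L(v)$. A \emph{$k$-fold cover} of $G$ is a pair $\mathcal H=(L,H)$, where $L$ is a list $k$-assignment and $H$ is a graph with vertex set $\bigcup_{v\in V}L_v$ such that $H[L_v]$ is complete for every $v\in V$ and, for distinct $u,v\in V$, the set of edges of $H$ between $L_u$ and $L_v$ is a (possibly empty) matching if $uv\in E$ and is empty if $uv\notin E$. Let $H^*$ be obtained from $H$ by removing all edges inside the sets $L_v$; the cover $\mathcal H$ is \emph{triangle-free} if $H^*$ contains no triangle. The graph $G$ is \emph{$\mathcal H$-colourable} if $H$ has an independent set of size $|V|$. \textbf{Theorem.} For every $0<\varepsilon<1/3$ there exists $\Delta_\varepsilon$ such that every finite graph $G$ with maximum degree $\Delta\ge\Delta_\varepsilon$ is $\mathcal H$-colourable for every triangle-free $n$-fold cover $\mathcal H$ of $G$ with $n\ge\lfloor(1+4\varepsilon)\Delta/\log\Delta\rfloor$, where $\log$ is the natural logarithm. -/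

import Mathlib

/-- A `k`-fold cover `(L, H)` of a graph `G`: a list `k`-assignment `L` (the colours are positive
integers), with a graph `H` whose vertices are the pairs `(v, c)`, `c ∈ L v`. The pairs with first
coordinate `v` form the `v`-set `L_v`. -/
structure DPCover {V : Type*} (G : SimpleGraph V) (k : ℕ) where
  /-- the list assignment -/
  L : V → Finset ℕ+
  card_L : ∀ v, (L v).card = k
  /-- the cover graph -/
  H : SimpleGraph (Σ v : V, L v)
  /-- each `H[L_v]` is complete -/
  complete : ∀ x y : (Σ v : V, L v), x.1 = y.1 → x ≠ y → H.Adj x y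
  /-- if `uv` is an edge of `G`, the edges between `L_u` and `L_v` form a (possibly empty) matching;
  as the condition is imposed on `(u, v)` and on `(v, u)`, no two of them share an end on either
  side -/
  matching : ∀ u v : V, G.Adj u v → ∀ x y z : (Σ v : V, L v),
    x.1 = u → y.1 = v → z.1 = v → H.Adj x y → H.Adj x z → y = z
  /-- if `u ≠ v` are not adjacent in `G`, there are no edges between `L_u` and `L_v` -/
  no_edge : ∀ u v : V, u ≠ v → ¬ G.Adj u v → ∀ x y : (Σ v : V, L v),
    x.1 = u → y.1 = v → ¬ H.Adj x y

namespace DPCover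

/-- The graph `H*`: the cover graph with all edges inside the `v`-sets removed. -/
def Hstar {V : Type*} {G : SimpleGraph V} {k : ℕ} (C : DPCover G k) :
    SimpleGraph (Σ v : V, C.L v) where
  Adj x y := C.H.Adj x y ∧ x.1 ≠ y.1
  symm := ⟨fun _ _ h => ⟨h.1.symm, h.2.symm⟩⟩
  loopless := ⟨fun _ h => h.2 rfl⟩

/-- The cover is triangle-free: `H*` has no triangle. -/
def TriangleFree {V : Type*} {G : SimpleGraph V} {k : ℕ} (C : DPCover G k) : Prop :=
  C.Hstar.CliqueFree 3

/-- `G` is `(L, H)`-colourable: `H` has an independent set of size `|V|`. -/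
def Colourable {V : Type*} [Fintype V] {G : SimpleGraph V} {k : ℕ} (C : DPCover G k) : Prop :=
  ∃ I : Finset (Σ v : V, C.L v), C.H.IsIndepSet (I : Set (Σ v : V, C.L v)) ∧
    I.card = Fintype.card V

end DPCover

/-!
The colouring is found in two steps. A random partial colouring `I` is drawn from the hard-core
model on the cover graph `H`: an independent set `I` has weight `ε ^ |I|`. The Lovász local lemma
shows that with positive probability every vertex keeps many available colours, and that every
available colour conflicts with few colours of uncoloured neighbours; such an `I` then extends to
a full colouring, by Rosenfeld's counting argument (`card_transversals_insert`).

The local analysis at a vertex `v` rests on one fact. For a colour `x` of `v`, let `N(x)` be its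
set of neighbours outside the fibre of `v`. By triangle-freeness and the matching condition it is
independent in `H`, so that, given `I \ N(x)`, each free vertex of `N(x)` (one with no neighbour
in `I`) is in `I` independently with probability `p = ε / (1 + ε)`
(`sum_hardCore_disjoint`, `sum_hardCore_card`). There are two consequences.

* If `f` vertices of `N(x)` are free, then `x` is available with probability `(1 + ε) ^ (-f)`. Hence
  an available colour has more than logarithmically many free neighbours with only polynomially
  small probability (`IsTriangleFreeCover.mass_card_free_ge`).
* Resampling `I` on `N(x)` changes the availability of `x` but, the sets `N(x)` being disjoint, of
  no other colour of `v`. Comparing the masses of "`j` colours are available" and "`j + 1` colours are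
  available" through this reversible move gives a ratio of at least
  `(k - j) exp (-(1 + ε) Δ / (k - j)) / (j + 1)`
  (`IsTriangleFreeCover.mass_card_avail_le`). The exponent comes from Jensen's inequality: at most
  `Δ` vertices of the sets `N(x)` lie in `I`, so those of unavailable colours have at most `Δ / p`
  free vertices on average in total, even conditionally on the value `j`. For `k` close to `(1 + 4 ε) Δ / log Δ` the
  ratio is at least of order `Δ ^ ε / log Δ` divided by `j + 1`, so having only logarithmically many
  available colours is polynomially unlikely as well, whatever happens away from the neighbours
  of `v` (`IsTriangleFreeCover.mass_card_avail_lt`).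

The graph `G` itself may contain triangles: the colours of the neighbours of `v` need not be
independent, and none of the above uses that.
-/

/-! ### The lopsided local lemma -/

section Classical
open Classical Finset

/-- **Lopsided Lovász local lemma**, symmetric form, for a finite weighted space `s`. The
hypothesis `hBad` says that, conditionally on avoiding any events outside `Γ i`, the event `Bad i`
has probability at most `q`. -/
theorem exists_forall_not_of_lopsided {Ω ι : Type*} [Fintype ι] (s : Finset Ω) (μ : Ω → ℝ)
    (hμ : ∀ ω ∈ s, 0 ≤ μ ω) (hpos : 0 < ∑ ω ∈ s, μ ω) (Bad : ι → Ω → Prop) (Γ : ι → Finset ι)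
    (q : ℝ) (D : ℕ) (hD : 1 ≤ D) (hq : 4 * q * D ≤ 1) (hq₀ : 0 ≤ q) (hΓ : ∀ i, #(Γ i) ≤ D)
    (hBad : ∀ i, ∀ S : Finset ι, Disjoint S (Γ i) →
      ∑ ω ∈ s with (Bad i ω ∧ ∀ j ∈ S, ¬ Bad j ω), μ ω ≤
        q * ∑ ω ∈ s with (∀ j ∈ S, ¬ Bad j ω), μ ω) :
    ∃ ω ∈ s, ∀ i, ¬ Bad i ω := by
  have nonneg : ∀ (p : Ω → Prop) [DecidablePred p], 0 ≤ ∑ ω ∈ s with p ω, μ ω := fun p _ =>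
    sum_nonneg fun ω hω => hμ ω (mem_filter.1 hω).1
  have mono : ∀ (p p' : Ω → Prop) [DecidablePred p] [DecidablePred p'], (∀ ω, p ω → p' ω) →
      ∑ ω ∈ s with p ω, μ ω ≤ ∑ ω ∈ s with p' ω, μ ω := fun p p' _ _ h =>
    sum_le_sum_of_subset_of_nonneg (fun ω hω => by
      rw [mem_filter] at hω ⊢; exact ⟨hω.1, h _ hω.2⟩)
      fun ω hω _ => hμ ω (mem_filter.1 hω).1
  -- Discarding the outcomes on which some event of `S₁` occurs costs at most the sum of the
  -- masses of these events.
  have union : ∀ (S₂ S₁ : Finset ι), ∑ ω ∈ s with (∀ j ∈ S₂, ¬ Bad j ω), μ ω ≤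
      ∑ ω ∈ s with (∀ j ∈ S₂ ∪ S₁, ¬ Bad j ω), μ ω +
        ∑ i ∈ S₁, ∑ ω ∈ s with (Bad i ω ∧ ∀ j ∈ S₂, ¬ Bad j ω), μ ω := by
    intro S₂ S₁
    simp_rw [sum_filter]
    rw [sum_comm, ← sum_add_distrib]
    refine sum_le_sum fun ω hω => ?_
    have h0 := hμ ω hω
    have hs : ∀ i ∈ S₁, 0 ≤ if Bad i ω ∧ ∀ j ∈ S₂, ¬ Bad j ω then μ ω else 0 := by
      intro i _; split_ifs <;> simp [h0]
    by_cases h2 : ∀ j ∈ S₂, ¬ Bad j ω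
    · rw [if_pos h2]
      by_cases h1 : ∀ j ∈ S₂ ∪ S₁, ¬ Bad j ω
      · rw [if_pos h1]; linarith [sum_nonneg hs]
      · rw [if_neg h1]
        push Not at h1
        obtain ⟨i, hi, hb⟩ := h1
        have hi1 : i ∈ S₁ := (mem_union.1 hi).resolve_left fun h => h2 i h hb
        have := single_le_sum hs hi1
        rw [if_pos ⟨hb, h2⟩] at this
        linarith
    · rw [if_neg h2]
      have := sum_nonneg hs
      split_ifs <;> linarith
  -- Conditioning on the whole of `S`, including events in `Γ i`, costs at most a factor `2`.
  have key : ∀ (m : ℕ) (S : Finset ι), #S = m → ∀ i,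
      ∑ ω ∈ s with (Bad i ω ∧ ∀ j ∈ S, ¬ Bad j ω), μ ω ≤
        2 * q * ∑ ω ∈ s with (∀ j ∈ S, ¬ Bad j ω), μ ω := by
    intro m
    induction m using Nat.strong_induction_on with
    | _ m ih =>
      intro S hS i
      have h1 := hBad i (S \ Γ i) sdiff_disjoint
      have h2 : ∑ ω ∈ s with (Bad i ω ∧ ∀ j ∈ S, ¬ Bad j ω), μ ω ≤
          ∑ ω ∈ s with (Bad i ω ∧ ∀ j ∈ S \ Γ i, ¬ Bad j ω), μ ω :=
        mono (fun ω => Bad i ω ∧ ∀ j ∈ S, ¬ Bad j ω)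
            (fun ω => Bad i ω ∧ ∀ j ∈ S \ Γ i, ¬ Bad j ω) fun ω h =>
              ⟨h.1, fun j hj => h.2 j (mem_sdiff.1 hj).1⟩
      by_cases hd : S ∩ Γ i = ∅
      · have : S \ Γ i = S := sdiff_eq_self_of_disjoint (disjoint_iff_inter_eq_empty.2 hd)
        rw [this] at h1
        have := mul_nonneg hq₀ (nonneg fun ω => ∀ j ∈ S, ¬ Bad j ω)
        linarith
      · have hlt : #(S \ Γ i) < m := by
          have := card_sdiff_add_card_inter S (Γ i)
          have := card_pos.2 (nonempty_iff_ne_empty.2 hd)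
          omega
        have h3 := union (S \ Γ i) (S ∩ Γ i)
        rw [sdiff_union_inter] at h3
        have h4 : ∑ i' ∈ S ∩ Γ i, ∑ ω ∈ s with (Bad i' ω ∧ ∀ j ∈ S \ Γ i, ¬ Bad j ω), μ ω ≤
            ∑ i' ∈ S ∩ Γ i, 2 * q * ∑ ω ∈ s with (∀ j ∈ S \ Γ i, ¬ Bad j ω), μ ω :=
          sum_le_sum fun i' _ => ih _ hlt _ rfl i'
        rw [sum_const, nsmul_eq_mul] at h4
        set Z := ∑ ω ∈ s with (∀ j ∈ S \ Γ i, ¬ Bad j ω), μ ω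
        have hZ : 0 ≤ Z := nonneg _
        have hc : (#(S ∩ Γ i) : ℝ) ≤ D := by
          exact_mod_cast (card_le_card inter_subset_right).trans (hΓ i)
        have h5 : (#(S ∩ Γ i) : ℝ) * (2 * q * Z) ≤ D * (2 * q * Z) := by gcongr
        have h6 : (D : ℝ) * (2 * q * Z) ≤ Z / 2 := by nlinarith
        have h7 : Z ≤ 2 * ∑ ω ∈ s with (∀ j ∈ S, ¬ Bad j ω), μ ω := by linarith
        calc _ ≤ q * Z := h2.trans h1
          _ ≤ q * (2 * ∑ ω ∈ s with (∀ j ∈ S, ¬ Bad j ω), μ ω) := by gcongr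
          _ = _ := by ring
  have hq' : q ≤ 1 / 4 := by
    have : (1 : ℝ) ≤ D := by exact_mod_cast hD
    nlinarith
  have hall : ∀ S : Finset ι, 0 < ∑ ω ∈ s with (∀ j ∈ S, ¬ Bad j ω), μ ω := by
    intro S
    induction S using Finset.induction_on with
    | empty => simpa using hpos
    | insert i S hi ih =>
      have h3 := union S {i}
      rw [union_singleton, sum_singleton] at h3
      have := key _ S rfl i
      nlinarith
  obtain ⟨ω, hω, -⟩ := exists_ne_zero_of_sum_ne_zero (hall univ).ne'
  rw [mem_filter] at hω
  exact ⟨ω, hω.1, fun i => hω.2 i (mem_univ i)⟩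

end Classical

/-! ### The hard-core model on an independent set -/

section Classical
open Classical Finset

variable {V W : Type*} [Fintype W]

/-- The finite set of all independent sets of a graph. -/
noncomputable def indepSets (H : SimpleGraph W) : Finset (Finset W) :=
  univ.filter fun I => H.IsIndepSet (I : Set W)

/-- The vertices of `N` without neighbour in `I`. A vertex of `N ∩ I` counts as free when `I` is
independent, so that, for `N` independent, this set depends on `I \ N` only. -/
noncomputable def freeIn (H : SimpleGraph W) (N I : Finset W) : Finset W :=
  N.filter fun y => ∀ z ∈ I, ¬ H.Adj y z

theorem mem_indepSets {H : SimpleGraph W} {I : Finset W} :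
    I ∈ indepSets H ↔ ∀ x ∈ I, ∀ y ∈ I, ¬ H.Adj x y := by
  simp only [indepSets, mem_filter, mem_univ, true_and]
  constructor
  · intro h x hx y hy hxy
    exact h hx hy hxy.ne hxy
  · intro h x hx y hy _
    exact h x hx y hy

theorem freeIn_congr {H : SimpleGraph W} {N : Finset W} (hN : ∀ x ∈ N, ∀ y ∈ N, ¬ H.Adj x y)
    {I J : Finset W} (h : I \ N = J \ N) : freeIn H N I = freeIn H N J := by
  have aux : ∀ I J : Finset W, I \ N = J \ N → freeIn H N I ⊆ freeIn H N J := by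
    intro I J h y hy
    rw [freeIn, mem_filter] at hy ⊢
    refine ⟨hy.1, fun z hz hyz => ?_⟩
    by_cases hzN : z ∈ N
    · exact hN y hy.1 z hzN hyz
    · have : z ∈ I \ N := h ▸ mem_sdiff.2 ⟨hz, hzN⟩
      exact hy.2 z (mem_sdiff.1 this).1 hyz
  exact (aux I J h).antisymm (aux J I h.symm)

/-- In the hard-core model with fugacity `lam`, an independent set `N` is unoccupied with
conditional probability `(1 + lam) ^ (-f)`, where `f` is the number of free vertices of `N`. -/
theorem sum_hardCore_disjoint {H : SimpleGraph W} {N : Finset W}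
    (hN : ∀ x ∈ N, ∀ y ∈ N, ¬ H.Adj x y) (lam : ℝ) (φ : Finset W → ℝ)
    (hφ : ∀ I J, I \ N = J \ N → φ I = φ J) :
    ∑ I ∈ indepSets H with Disjoint N I, lam ^ #I * (φ I * (1 + lam) ^ #(freeIn H N I)) =
      ∑ I ∈ indepSets H, lam ^ #I * φ I := by
  have hmaps : ∀ I ∈ indepSets H, I \ N ∈ (indepSets H).filter fun I => Disjoint N I := by
    intro I hI
    rw [mem_filter, mem_indepSets]
    rw [mem_indepSets] at hI
    exact ⟨fun x hx y hy => hI x (mem_sdiff.1 hx).1 y (mem_sdiff.1 hy).1, disjoint_sdiff⟩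
  rw [← sum_fiberwise_of_maps_to hmaps]
  refine sum_congr rfl fun J hJ => ?_
  rw [mem_filter, mem_indepSets] at hJ
  obtain ⟨hJ, hd⟩ := hJ
  have hJN : J \ N = J := sdiff_eq_self_of_disjoint hd.symm
  have : ∑ I ∈ indepSets H with I \ N = J, lam ^ #I * φ I =
      ∑ T ∈ (freeIn H N J).powerset, lam ^ #J * φ J * lam ^ #T := by
    refine sum_nbij' (fun I => I ∩ N) (fun T => J ∪ T) ?_ ?_ ?_ ?_ ?_
    · intro I hI
      rw [mem_filter, mem_indepSets] at hI
      rw [mem_powerset]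
      intro y hy
      rw [freeIn, mem_filter]
      refine ⟨(mem_inter.1 hy).2, fun z hz => hI.1 y (mem_inter.1 hy).1 z ?_⟩
      rw [← hI.2] at hz
      exact (mem_sdiff.1 hz).1
    · intro T hT
      rw [mem_powerset] at hT
      have hTN : T ⊆ N := hT.trans (filter_subset _ _)
      rw [mem_filter, mem_indepSets]
      constructor
      · intro x hx y hy
        rw [mem_union] at hx hy
        rcases hx with hx | hx <;> rcases hy with hy | hy
        · exact hJ x hx y hy
        · exact fun h => (mem_filter.1 (hT hy)).2 x hx h.symm
        · exact (mem_filter.1 (hT hx)).2 y hy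
        · exact hN x (hTN hx) y (hTN hy)
      · rw [union_sdiff_distrib, hJN, sdiff_eq_empty_iff_subset.2 hTN, union_empty]
    · intro I hI
      rw [mem_filter] at hI
      simp only [← hI.2, sdiff_union_inter]
    · intro T hT
      rw [mem_powerset] at hT
      have hTN : T ⊆ N := hT.trans (filter_subset _ _)
      simp only [union_inter_distrib_right, inter_eq_left.2 hTN,
        disjoint_iff_inter_eq_empty.1 hd.symm, empty_union]
    · intro I hI
      rw [mem_filter] at hI
      have h1 : φ I = φ J := hφ _ _ (hI.2.trans hJN.symm)
      have h2 := card_sdiff_add_card_inter I N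
      rw [hI.2] at h2
      rw [h1, ← h2, pow_add]
      ring
  rw [this, ← mul_sum]
  have hb := sum_pow_mul_eq_add_pow lam 1 (freeIn H N J)
  simp only [one_pow, mul_one] at hb
  rw [hb, add_comm lam 1]
  ring

theorem sum_hardCore_mem {H : SimpleGraph W} (y : W) (lam : ℝ) (φ : Finset W → ℝ)
    (hφ : ∀ I J, I \ {y} = J \ {y} → φ I = φ J) :
    lam * ∑ I ∈ indepSets H with (∀ z ∈ I, ¬ H.Adj y z), lam ^ #I * φ I =
      (1 + lam) * ∑ I ∈ indepSets H with y ∈ I, lam ^ #I * φ I := by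
  have hN : ∀ x ∈ ({y} : Finset W), ∀ z ∈ ({y} : Finset W), ¬ H.Adj x z := by simp
  have hfree : ∀ I, (∀ z ∈ I, ¬ H.Adj y z) ↔ y ∈ freeIn H {y} I := by simp [freeIn]
  have h := sum_hardCore_disjoint hN lam
    (fun I => if ∀ z ∈ I, ¬ H.Adj y z then φ I else 0) (fun I J hIJ => by
      simp only [hfree, freeIn_congr hN hIJ, hφ I J hIJ])
  have e1 : ∑ I ∈ indepSets H with (∀ z ∈ I, ¬ H.Adj y z), lam ^ #I * φ I =
      ∑ I ∈ indepSets H, lam ^ #I * (if ∀ z ∈ I, ¬ H.Adj y z then φ I else 0) := by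
    rw [sum_filter]
    exact sum_congr rfl fun I _ => by split_ifs <;> simp
  have e2 : ∑ I ∈ indepSets H with Disjoint {y} I, lam ^ #I *
      ((if ∀ z ∈ I, ¬ H.Adj y z then φ I else 0) * (1 + lam) ^ #(freeIn H {y} I)) =
      (1 + lam) * ∑ I ∈ indepSets H with y ∉ I,
        lam ^ #I * (if ∀ z ∈ I, ¬ H.Adj y z then φ I else 0) := by
    rw [mul_sum]
    refine sum_congr (by simp) fun I _ => ?_
    split_ifs with hI
    · have : freeIn H {y} I = {y} := by
        rw [freeIn, filter_singleton, if_pos hI]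
      rw [this, card_singleton]
      ring
    · simp
  have e3 : ∑ I ∈ indepSets H with y ∈ I, lam ^ #I * φ I =
      ∑ I ∈ indepSets H with y ∈ I, lam ^ #I * (if ∀ z ∈ I, ¬ H.Adj y z then φ I else 0) := by
    refine sum_congr rfl fun I hI => ?_
    rw [mem_filter, mem_indepSets] at hI
    rw [if_pos fun z hz => hI.1 y hI.2 z hz]
  have e4 := sum_filter_add_sum_filter_not (indepSets H) (fun I => y ∈ I)
    (fun I => lam ^ #I * (if ∀ z ∈ I, ¬ H.Adj y z then φ I else 0))
  rw [e2] at h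
  rw [e1, e3]
  linear_combination h - (1 + lam) * e4

/-- In the hard-core model with fugacity `lam`, each free vertex of a set `N` is
occupied with conditional probability `lam / (1 + lam)`. -/
theorem sum_hardCore_card {H : SimpleGraph W} {N : Finset W} (lam : ℝ) (φ : Finset W → ℝ)
    (hφ : ∀ I J, I \ N = J \ N → φ I = φ J) :
    lam * ∑ I ∈ indepSets H, lam ^ #I * (φ I * #(freeIn H N I)) =
      (1 + lam) * ∑ I ∈ indepSets H, lam ^ #I * (φ I * #(N ∩ I)) := by
  have e1 : ∑ I ∈ indepSets H, lam ^ #I * (φ I * #(freeIn H N I)) =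
      ∑ y ∈ N, ∑ I ∈ indepSets H with (∀ z ∈ I, ¬ H.Adj y z), lam ^ #I * φ I := by
    simp_rw [sum_filter]
    rw [sum_comm]
    refine sum_congr rfl fun I _ => ?_
    rw [← sum_filter, sum_const, nsmul_eq_mul, freeIn]
    ring
  have e2 : ∑ I ∈ indepSets H, lam ^ #I * (φ I * #(N ∩ I)) =
      ∑ y ∈ N, ∑ I ∈ indepSets H with y ∈ I, lam ^ #I * φ I := by
    simp_rw [sum_filter]
    rw [sum_comm]
    refine sum_congr rfl fun I _ => ?_
    rw [← sum_filter, sum_const, nsmul_eq_mul, filter_mem_eq_inter]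
    ring
  rw [e1, e2, mul_sum, mul_sum]
  refine sum_congr rfl fun y hy => sum_hardCore_mem y lam φ fun I J hIJ => hφ I J ?_
  have : ∀ K : Finset W, K \ N = (K \ {y}) \ N := by
    intro K; ext z; simp only [mem_sdiff, mem_singleton]
    constructor
    · rintro ⟨h1, h2⟩; exact ⟨⟨h1, fun h => h2 (h ▸ hy)⟩, h2⟩
    · rintro ⟨⟨h1, -⟩, h2⟩; exact ⟨h1, h2⟩
  rw [this I, this J, hIJ]

end Classical

/-! ### Available colours in the hard-core model on a cover -/

section Classical
open Classical Finset

variable {V W : Type*} [Fintype W]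

/-- A triangle-free cover of `G`, in unbundled form: a graph `H` on a type `W` of pairs
(vertex, colour), with `π` giving the vertex. The last field, saying that the neighbours of `x`
outside the fibre of `x` form an independent set, combines the matching condition (as the fibres
are cliques) with triangle-freeness. -/
structure IsTriangleFreeCover (G : SimpleGraph V) (π : W → V) (H : SimpleGraph W) : Prop where
  clique : ∀ x y, x ≠ y → π x = π y → H.Adj x y
  adj : ∀ x y, H.Adj x y → π y ≠ π x → G.Adj (π x) (π y)
  indep : ∀ x y z, H.Adj x y → π y ≠ π x → H.Adj x z → π z ≠ π x → ¬ H.Adj y z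

/-- The neighbours of `x` outside the fibre of `x`. -/
noncomputable def outer (π : W → V) (H : SimpleGraph W) (x : W) : Finset W :=
  univ.filter fun y => H.Adj x y ∧ π y ≠ π x

/-- The colours of `v` that conflict with no coloured neighbour of `v`, for the partial
colouring `I`. -/
noncomputable def avail (π : W → V) (H : SimpleGraph W) (v : V) (I : Finset W) : Finset W :=
  univ.filter fun x => π x = v ∧ Disjoint (outer π H x) I

/-- The property `E` of partial colourings does not depend on the colours of the neighbours
of `v`. -/
def IgnoresNeighbors (G : SimpleGraph V) (π : W → V) (v : V) (E : Finset W → Prop) : Prop :=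
  ∀ I J : Finset W, (∀ y, ¬ G.Adj v (π y) → (y ∈ I ↔ y ∈ J)) → (E I ↔ E J)

variable {G : SimpleGraph V} {π : W → V} {H : SimpleGraph W}

theorem mem_outer {x y : W} : y ∈ outer π H x ↔ H.Adj x y ∧ π y ≠ π x := by simp [outer]

theorem mem_avail {v : V} {I : Finset W} {x : W} :
    x ∈ avail π H v I ↔ π x = v ∧ Disjoint (outer π H x) I := by simp [avail]

theorem IsTriangleFreeCover.outer_indep (hc : IsTriangleFreeCover G π H) (x : W) :
    ∀ y ∈ outer π H x, ∀ z ∈ outer π H x, ¬ H.Adj y z := by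
  intro y hy z hz
  rw [mem_outer] at hy hz
  exact hc.indep x y z hy.1 hy.2 hz.1 hz.2

theorem IsTriangleFreeCover.disjoint_outer (hc : IsTriangleFreeCover G π H) {x x' : W}
    (hne : x ≠ x') (h : π x = π x') : Disjoint (outer π H x) (outer π H x') := by
  rw [disjoint_left]
  intro y hy hy'
  rw [mem_outer] at hy hy'
  exact hc.indep y x x' hy.1.symm hy.2.symm hy'.1.symm hy'.2.symm (hc.clique x x' hne h)

theorem IsTriangleFreeCover.injOn (hc : IsTriangleFreeCover G π H) {I : Finset W}
    (hI : I ∈ indepSets H) : Set.InjOn π (I : Set W) := by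
  intro x hx y hy h
  by_contra hne
  exact mem_indepSets.1 hI x hx y hy (hc.clique x y hne h)

theorem IsTriangleFreeCover.ignores_outer (hc : IsTriangleFreeCover G π H) {v : V}
    {E : Finset W → Prop} (hE : IgnoresNeighbors G π v E) {x : W} (hx : π x = v)
    {I J : Finset W} (h : I \ outer π H x = J \ outer π H x) : E I ↔ E J := by
  refine hE I J fun y hy => ?_
  have hyx : y ∉ outer π H x := fun h => by
    rw [mem_outer] at h
    exact hy (hx ▸ hc.adj x y h.1 h.2)
  have := congrArg (y ∈ ·) h
  simpa [hyx] using this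

theorem IsTriangleFreeCover.erase_avail (hc : IsTriangleFreeCover G π H) {v : V}
    {x : W} (hx : π x = v) {I J : Finset W} (h : I \ outer π H x = J \ outer π H x) :
    (avail π H v I).erase x = (avail π H v J).erase x := by
  ext x'
  simp only [mem_erase, mem_avail]
  refine and_congr_right fun hne => and_congr_right fun hx' => ?_
  have hd := hc.disjoint_outer hne (hx'.trans hx.symm)
  simp only [disjoint_left]
  refine forall₂_congr fun y hy => ?_
  have := congrArg (y ∈ ·) h
  exact not_congr (by simpa [disjoint_left.1 hd hy] using this)

/-- An available colour rarely has many free neighbours, whatever happens away from the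
neighbours of `v`. -/
theorem IsTriangleFreeCover.mass_card_free_ge (hc : IsTriangleFreeCover G π H) {v : V}
    {x : W} (hx : π x = v) (s : ℕ) {lam : ℝ} (hl : 0 < lam)
    {E : Finset W → Prop} (hE : IgnoresNeighbors G π v E) :
    ∑ I ∈ indepSets H with
        (E I ∧ Disjoint (outer π H x) I ∧ s ≤ #(freeIn H (outer π H x) I)), lam ^ #I ≤
      ((1 + lam) ^ s)⁻¹ * ∑ I ∈ indepSets H with E I, lam ^ #I := by
  have h := sum_hardCore_disjoint (hc.outer_indep x) lam
    (fun I => if E I ∧ s ≤ #(freeIn H (outer π H x) I) then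
      ((1 + lam) ^ #(freeIn H (outer π H x) I))⁻¹ else 0) fun I J hIJ => by
        simp only [freeIn_congr (hc.outer_indep x) hIJ, hc.ignores_outer hE hx hIJ]
  calc _ = _ := by
        rw [sum_filter, sum_filter]
        refine sum_congr rfl fun I _ => ?_
        have : (1 + lam) ^ #(freeIn H (outer π H x) I) ≠ 0 := by positivity
        by_cases h1 : E I <;> by_cases h2 : Disjoint (outer π H x) I <;>
          by_cases h3 : s ≤ #(freeIn H (outer π H x) I) <;> simp [h1, h2, h3, this]
    _ = _ := h
    _ ≤ _ := by
        rw [mul_sum, sum_filter]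
        refine sum_le_sum fun I _ => ?_
        by_cases h1 : E I
        · by_cases h3 : s ≤ #(freeIn H (outer π H x) I)
          · simp only [h1, h3, and_self, if_true]
            rw [mul_comm]
            gcongr
            linarith
          · simp only [h1, h3, and_false, if_false, if_true, mul_zero]
            positivity
        · simp [h1]

variable [Fintype V]

theorem IsTriangleFreeCover.sum_card_outer_inter_le (hc : IsTriangleFreeCover G π H) {v : V}
    {d : ℕ} (hd : #{u | G.Adj v u} ≤ d) {I : Finset W} (hI : I ∈ indepSets H) :
    ∑ x with π x = v, #(outer π H x ∩ I) ≤ d := by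
  rw [← card_biUnion]
  · refine (card_le_card_of_injOn π ?_ ?_).trans hd
    · intro y hy
      simp only [coe_biUnion, coe_filter, mem_univ, true_and, Set.mem_iUnion, coe_inter,
        Set.mem_inter_iff, mem_coe, mem_outer, Set.mem_ofPred_eq] at hy ⊢
      obtain ⟨x, hx, ⟨hy, hne⟩, -⟩ := hy
      exact hx ▸ hc.adj x y hy hne
    · refine (hc.injOn hI).mono fun y hy => ?_
      simp only [coe_biUnion, Set.mem_iUnion, coe_inter, Set.mem_inter_iff] at hy
      obtain ⟨x, -, -, hy⟩ := hy
      exact hy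
  · intro x hx x' hx' hne
    rw [mem_coe, mem_filter] at hx hx'
    exact (hc.disjoint_outer hne (hx.2.trans hx'.2.symm)).mono inter_subset_left inter_subset_left

/-- The masses of the events "exactly `j` colours of `v` are available" increase by a definite
factor from `j` to `j + 1`. The set `outer π H x` of a colour `x` of `v` is resampled: this
affects the availability of no other colour of `v`, and it makes `x` available with probability
`(1 + lam) ^ (-f)`, where on average over the `k - j` unavailable colours the number `f` of free
vertices is at most `(1 + lam) / lam * d / (k - j)`, because at most `d` neighbours of `v` are
coloured. -/
theorem IsTriangleFreeCover.mass_card_avail_le (hc : IsTriangleFreeCover G π H) {v : V}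
    {d k j : ℕ} (hd : #{u | G.Adj v u} ≤ d) (hk : #{x | π x = v} = k) (hj : j < k)
    {lam : ℝ} (hl : 0 < lam) {E : Finset W → Prop} (hE : IgnoresNeighbors G π v E) :
    ((k : ℝ) - j) * Real.exp (-((1 + lam) * d / (k - j))) *
        ∑ I ∈ indepSets H with (E I ∧ #(avail π H v I) = j), lam ^ #I ≤
      (j + 1) * ∑ I ∈ indepSets H with (E I ∧ #(avail π H v I) = j + 1), lam ^ #I := by
  set X : Finset W := {x | π x = v} with hX
  have hAX : ∀ I, avail π H v I ⊆ X := fun I x hx => by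
    rw [hX, mem_filter]; exact ⟨mem_univ _, (mem_avail.1 hx).1⟩
  have hmemX : ∀ x, x ∈ X ↔ π x = v := by simp [hX]
  -- The event for `x` that disregards whether `x` itself is available.
  let φ : W → Finset W → ℝ := fun x I => if E I ∧ #((avail π H v I).erase x) = j then 1 else 0
  have hφ : ∀ x ∈ X, ∀ I J, I \ outer π H x = J \ outer π H x → φ x I = φ x J := by
    intro x hx I J h
    simp only [φ]
    rw [hc.erase_avail ((hmemX x).1 hx) h]
    simp only [hc.ignores_outer hE ((hmemX x).1 hx) h]
  have hφ0 : ∀ x I, 0 ≤ φ x I := fun x I => by simp only [φ]; split_ifs <;> simp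
  have hw : ∀ I : Finset W, 0 ≤ lam ^ #I := fun I => by positivity
  let f : W → Finset W → ℕ := fun x I => #(freeIn H (outer π H x) I)
  have hf : ∀ x I J, I \ outer π H x = J \ outer π H x → f x I = f x J := fun x I J h => by
    simp only [f, freeIn_congr (hc.outer_indep x) h]
  set P : ℝ := ∑ I ∈ indepSets H with (E I ∧ #(avail π H v I) = j), lam ^ #I with hP
  set P' : ℝ := ∑ I ∈ indepSets H with (E I ∧ #(avail π H v I) = j + 1), lam ^ #I with hP'
  have hP0 : 0 ≤ P := sum_nonneg fun I _ => hw I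
  -- The mass of the outcomes of a resampling that are available, summed over the colours.
  have upper : ∑ x ∈ X, ∑ I ∈ indepSets H, lam ^ #I * (φ x I * ((1 + lam) ^ f x I)⁻¹) =
      (j + 1) * P' := by
    have h1 : ∀ x ∈ X, ∑ I ∈ indepSets H, lam ^ #I * (φ x I * ((1 + lam) ^ f x I)⁻¹) =
        ∑ I ∈ indepSets H, if x ∈ avail π H v I then
          (if E I ∧ #(avail π H v I) = j + 1 then lam ^ #I else 0) else 0 := by
      intro x hx
      rw [← sum_hardCore_disjoint (hc.outer_indep x) lam
        (fun I => φ x I * ((1 + lam) ^ f x I)⁻¹) fun I J h => by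
          simp only [hφ x hx I J h, hf x I J h], sum_filter]
      refine sum_congr rfl fun I _ => ?_
      have hav : x ∈ avail π H v I ↔ Disjoint (outer π H x) I := by
        rw [mem_avail]; exact and_iff_right ((hmemX x).1 hx)
      simp only [← hav]
      split_ifs with h1 h2
      · have : φ x I = 1 := if_pos ⟨h2.1, by rw [card_erase_of_mem h1, h2.2]; rfl⟩
        rw [this, one_mul, inv_mul_cancel₀ (by positivity), mul_one]
      · have : φ x I = 0 := if_neg fun h => h2 ⟨h.1, by
          rw [card_erase_of_mem h1] at h
          have := card_pos.2 ⟨x, h1⟩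
          omega⟩
        rw [this]; simp
      · rfl
    rw [sum_congr rfl h1, sum_comm, hP', sum_filter, mul_sum]
    refine sum_congr rfl fun I _ => ?_
    rw [← sum_filter, filter_mem_eq_inter, inter_eq_right.2 (hAX I), sum_const, nsmul_eq_mul]
    split_ifs with h
    · rw [h.2]; push_cast; ring
    · simp
  have hun : ∀ x I, φ x I * (if x ∈ avail π H v I then 0 else 1) =
      if x ∈ avail π H v I then 0 else if E I ∧ #(avail π H v I) = j then 1 else 0 := by
    intro x I
    split_ifs with h1 h2
    · simp
    · rw [mul_one]; exact if_pos ⟨h2.1, by rw [erase_eq_of_notMem h1, h2.2]⟩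
    · rw [mul_one]; exact if_neg fun h => h2 ⟨h.1, by rw [erase_eq_of_notMem h1] at h; exact h.2⟩
  have total : ∑ x ∈ X, ∑ I ∈ indepSets H,
      lam ^ #I * (φ x I * (if x ∈ avail π H v I then 0 else 1)) = (k - j) * P := by
    simp_rw [hun]
    rw [sum_comm, hP, sum_filter, mul_sum]
    refine sum_congr rfl fun I _ => ?_
    rw [← mul_sum]
    by_cases h : E I ∧ #(avail π H v I) = j
    · have : ∀ x ∈ X, (if x ∈ avail π H v I then (0 : ℝ) else
          if E I ∧ #(avail π H v I) = j then 1 else 0) = 1 - if x ∈ avail π H v I then 1 else 0 := by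
        intro x _; rw [if_pos h]; split_ifs <;> simp
      rw [sum_congr rfl this, if_pos h, sum_sub_distrib, sum_const, hk, ← sum_filter,
        filter_mem_eq_inter, inter_eq_right.2 (hAX I), sum_const, h.2]
      simp; ring
    · simp [if_neg h]
  -- An occupied vertex of `outer π H x` makes `x` unavailable, so that the condition on `x` can be
  -- dropped before free vertices are traded for occupied ones, and restored afterwards.
  have free : lam * ∑ x ∈ X, ∑ I ∈ indepSets H,
      lam ^ #I * (φ x I * (if x ∈ avail π H v I then 0 else 1) * f x I) ≤ (1 + lam) * d * P := by
    calc _ ≤ lam * ∑ x ∈ X, ∑ I ∈ indepSets H, lam ^ #I * (φ x I * f x I) := by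
          gcongr with x _ I _
          have := hφ0 x I
          split_ifs <;> simp [this]
      _ = ∑ x ∈ X, (1 + lam) * ∑ I ∈ indepSets H, lam ^ #I * (φ x I * #(outer π H x ∩ I)) := by
          rw [mul_sum]
          exact sum_congr rfl fun x hx => sum_hardCore_card lam (φ x) (hφ x hx)
      _ = (1 + lam) * ∑ I ∈ indepSets H with (E I ∧ #(avail π H v I) = j),
            lam ^ #I * ∑ x ∈ X, (#(outer π H x ∩ I) : ℝ) := by
          rw [← mul_sum, sum_comm, sum_filter]
          congr 1
          refine sum_congr rfl fun I _ => ?_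
          rw [← mul_sum]
          have : ∀ x ∈ X, φ x I * (#(outer π H x ∩ I) : ℝ) =
              (if E I ∧ #(avail π H v I) = j then 1 else 0) * #(outer π H x ∩ I) := by
            intro x hx
            by_cases h : Disjoint (outer π H x) I
            · rw [disjoint_iff_inter_eq_empty.1 h]; simp
            · have : x ∉ avail π H v I := fun h' => h (mem_avail.1 h').2
              simp only [φ]
              rw [erase_eq_of_notMem this]
          rw [sum_congr rfl this, ← mul_sum]
          split_ifs <;> simp
      _ ≤ (1 + lam) * ∑ I ∈ indepSets H with (E I ∧ #(avail π H v I) = j), lam ^ #I * d := by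
          gcongr with I hI
          exact_mod_cast hc.sum_card_outer_inter_le hd (mem_filter.1 hI).1
      _ = _ := by rw [← sum_mul, ← hP]; ring
  have hkj : (0 : ℝ) < k - j := by
    have : (j : ℝ) < k := by exact_mod_cast hj
    linarith
  set z : ℝ := (1 + lam) * d / (k - j) with hz
  -- The tangent of `exp` at `-z` replaces Jensen's inequality.
  have tangent : ∀ n : ℕ, Real.exp (-z) * (1 + z - lam * n) ≤ ((1 + lam) ^ n)⁻¹ := by
    intro n
    have h1 : (1 + lam) ^ n ≤ Real.exp (lam * n) := by
      calc (1 + lam) ^ n ≤ Real.exp lam ^ n := by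
            gcongr; linarith [Real.add_one_le_exp lam]
        _ = _ := by rw [← Real.exp_nat_mul, mul_comm]
    have h2 : Real.exp (-(lam * n)) ≤ ((1 + lam) ^ n)⁻¹ := by
      rw [Real.exp_neg]
      exact inv_anti₀ (by positivity) h1
    refine le_trans ?_ h2
    have h3 : -(lam * n) = -z + (z - lam * n) := by ring
    rw [h3, Real.exp_add]
    gcongr
    linarith [Real.add_one_le_exp (z - lam * n)]
  have lower : Real.exp (-z) * ((1 + z) * ((k - j) * P) - (1 + lam) * d * P) ≤ (j + 1) * P' := by
    rw [← upper]
    calc _ ≤ Real.exp (-z) * ((1 + z) * (∑ x ∈ X, ∑ I ∈ indepSets H,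
            lam ^ #I * (φ x I * (if x ∈ avail π H v I then 0 else 1))) -
          lam * ∑ x ∈ X, ∑ I ∈ indepSets H,
            lam ^ #I * (φ x I * (if x ∈ avail π H v I then 0 else 1) * f x I)) := by
          rw [total]; gcongr
      _ = ∑ x ∈ X, ∑ I ∈ indepSets H, lam ^ #I * (φ x I *
            (if x ∈ avail π H v I then 0 else 1) *
              (Real.exp (-z) * (1 + z - lam * f x I))) := by
          simp_rw [mul_sum, ← sum_sub_distrib, mul_sum]
          refine sum_congr rfl fun x _ => sum_congr rfl fun I _ => ?_
          ring
      _ ≤ _ := by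
          refine sum_le_sum fun x _ => sum_le_sum fun I _ =>
            mul_le_mul_of_nonneg_left ?_ (hw I)
          have h0 := hφ0 x I
          have hr : (0 : ℝ) ≤ ((1 + lam) ^ f x I)⁻¹ := by positivity
          have := tangent (f x I)
          split_ifs
          · rw [mul_zero, zero_mul]; positivity
          · rw [mul_one]; gcongr
  have hzz : z * (k - j) = (1 + lam) * d := by rw [hz]; field_simp
  calc _ = Real.exp (-z) * ((1 + z) * ((k - j) * P) - (1 + lam) * d * P) := by
        rw [← hzz]; ring
    _ ≤ _ := lower

/-- Lower tail of the number of available colours of `v`. For `j < 2 * t`, the mass of "exactly `j`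
available colours" at least doubles from `j` to `j + 1`, and the first `t` values of `j` are
compared with the next `t`. -/
theorem IsTriangleFreeCover.mass_card_avail_lt (hc : IsTriangleFreeCover G π H) {v : V}
    {d k t : ℕ} (hd : #{u | G.Adj v u} ≤ d) (hk : #{x | π x = v} = k) (ht : 2 * t < k)
    {lam : ℝ} (hl : 0 < lam)
    (hM : 4 * (t : ℝ) ≤ (k - 2 * t) * Real.exp (-((1 + lam) * d / (k - 2 * t))))
    {E : Finset W → Prop} (hE : IgnoresNeighbors G π v E) :
    ∑ I ∈ indepSets H with (E I ∧ #(avail π H v I) < t), lam ^ #I ≤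
      (1 / 2) ^ t * ∑ I ∈ indepSets H with E I, lam ^ #I := by
  set P : ℕ → ℝ := fun j => ∑ I ∈ indepSets H with (E I ∧ #(avail π H v I) = j), lam ^ #I with hP
  have hP0 : ∀ j, 0 ≤ P j := fun j => sum_nonneg fun I _ => by positivity
  have hkt : (0 : ℝ) < k - 2 * t := by
    have : (2 * t : ℝ) < k := by exact_mod_cast ht
    linarith
  have step : ∀ j < 2 * t, P j ≤ 1 / 2 * P (j + 1) := by
    intro j hj
    have h1 := hc.mass_card_avail_le hd hk (hj.trans ht) hl hE
    have hj' : (j : ℝ) + 1 ≤ 2 * t := by exact_mod_cast hj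
    have h2 : 4 * (t : ℝ) ≤ (k - j) * Real.exp (-((1 + lam) * d / (k - j))) := by
      refine hM.trans ?_
      have : (k : ℝ) - 2 * t ≤ k - j := by linarith
      have h0 : (0 : ℝ) ≤ k - j := hkt.le.trans this
      gcongr
    have h3 : 4 * (t : ℝ) * P j ≤ 2 * t * P (j + 1) := by
      calc _ ≤ _ := mul_le_mul_of_nonneg_right h2 (hP0 j)
        _ ≤ (j + 1) * P (j + 1) := h1
        _ ≤ _ := mul_le_mul_of_nonneg_right hj' (hP0 _)
    have ht0 : (0 : ℝ) < t := by
      have : (0 : ℝ) ≤ j := by positivity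
      linarith
    nlinarith
  have steps : ∀ m j, j + m ≤ 2 * t → P j ≤ (1 / 2) ^ m * P (j + m) := by
    intro m
    induction m with
    | zero => simp
    | succ m ih =>
      intro j hj
      calc P j ≤ (1 / 2) ^ m * P (j + m) := ih j (by omega)
        _ ≤ (1 / 2) ^ m * (1 / 2 * P (j + m + 1)) := by gcongr; exact step _ (by omega)
        _ = _ := by rw [pow_succ, ← add_assoc]; ring
  have e1 : ∑ I ∈ indepSets H with (E I ∧ #(avail π H v I) < t), lam ^ #I =
      ∑ j ∈ range t, P j := by
    simp only [hP, sum_filter]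
    rw [sum_comm]
    refine sum_congr rfl fun I _ => ?_
    by_cases h : E I <;> simp [h]
  have e2 : ∑ j ∈ range t, P (j + t) ≤ ∑ I ∈ indepSets H with E I, lam ^ #I := by
    simp only [hP, sum_filter]
    rw [sum_comm]
    refine sum_le_sum fun I _ => ?_
    by_cases h : E I
    · simp only [h, true_and, if_true]
      rw [← sum_filter, sum_const, nsmul_eq_mul]
      have : #{j ∈ range t | #(avail π H v I) = j + t} ≤ 1 := by
        rw [card_le_one]
        intro a ha b hb
        rw [mem_filter] at ha hb
        omega
      have h1 : (#{j ∈ range t | #(avail π H v I) = j + t} : ℝ) ≤ 1 := by exact_mod_cast this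
      have : 0 ≤ lam ^ #I := by positivity
      nlinarith
    · simp [h]
  rw [e1]
  calc _ ≤ ∑ j ∈ range t, (1 / 2) ^ t * P (j + t) :=
        sum_le_sum fun j hj => steps t j (by rw [mem_range] at hj; omega)
    _ ≤ _ := by rw [← mul_sum]; gcongr

end Classical

/-! ### Completing a partial colouring by counting -/

section Classical
open Classical Finset

variable {V W : Type*} [Fintype W]

/-- The independent sets inside `R` that contain exactly one vertex over each element of `X`, and
no other vertices. -/
noncomputable def transversals (π : W → V) (H : SimpleGraph W) (R : Finset W) (X : Finset V) :
    Finset (Finset W) :=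
  (indepSets H).filter fun T => T ⊆ R ∧ T.image π = X

theorem mem_transversals {π : W → V} {H : SimpleGraph W} {R : Finset W} {X : Finset V}
    {T : Finset W} : T ∈ transversals π H R X ↔
      (∀ x ∈ T, ∀ y ∈ T, ¬ H.Adj x y) ∧ T ⊆ R ∧ T.image π = X := by
  rw [transversals, mem_filter, mem_indepSets]

/-- Rosenfeld's counting argument: with lists of size at least `4 * s` and at most `s` conflicts
per colour, each new vertex multiplies the number of colourings by at least half of its list
size. -/
theorem card_transversals_insert {π : W → V} {H : SimpleGraph W} {R : Finset W} {s t : ℕ}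
    (hclique : ∀ x y, x ≠ y → π x = π y → H.Adj x y) (hst : 4 * s ≤ t) (ht : 1 ≤ t)
    {U : Finset V} (hR : ∀ v ∈ U, t ≤ #{x ∈ R | π x = v})
    (hs : ∀ x ∈ R, #{y ∈ R | H.Adj x y ∧ π y ≠ π x} ≤ s) (X : Finset V) :
    ∀ v ∉ X, insert v X ⊆ U → (t : ℝ) / 2 * #(transversals π H R X) ≤
      #(transversals π H R (insert v X)) := by
  induction X using Finset.strongInduction with
  | _ X ih =>
    intro v hv hU
    set L : Finset W := {x ∈ R | π x = v} with hL
    set C := transversals π H R X with hC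
    have ht0 : (0 : ℝ) < t := by exact_mod_cast ht
    have hLt : (t : ℝ) ≤ #L := by exact_mod_cast hR v (hU (mem_insert_self _ _))
    have hfib : ∀ T ∈ C, ∀ y ∈ T, π y ≠ v := fun T hT y hy h => hv (by
      rw [hC, mem_transversals] at hT
      rw [← hT.2.2, ← h]
      exact mem_image_of_mem _ hy)
    -- At most `s` conflicts per colour of `v`, each present in a fraction `2 / t` of `C`.
    have hconf : ∀ x ∈ L, (#{T ∈ C | ∃ y ∈ T, H.Adj x y} : ℝ) ≤ #C / 2 := by
      intro x hx
      rw [hL, mem_filter] at hx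
      have h1 : {T ∈ C | ∃ y ∈ T, H.Adj x y} ⊆
          ({y ∈ R | H.Adj x y ∧ π y ≠ π x} : Finset W).biUnion fun y => {T ∈ C | y ∈ T} := by
        intro T hT
        rw [mem_filter] at hT
        obtain ⟨hT, y, hy, hxy⟩ := hT
        simp only [mem_biUnion, mem_filter]
        refine ⟨y, ⟨(mem_transversals.1 hT).2.1 hy, hxy, ?_⟩, hT, hy⟩
        rw [hx.2]
        exact hfib T hT y hy
      have h2 : ∀ y, (#{T ∈ C | y ∈ T} : ℝ) ≤ 2 / t * #C := by
        intro y
        by_cases hy : π y ∈ X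
        · have h3 := ih (X.erase (π y)) (erase_ssubset hy) (π y) (notMem_erase _ _)
            (by rw [insert_erase hy]; exact (subset_insert _ _).trans hU)
          rw [insert_erase hy] at h3
          have h4 : #{T ∈ C | y ∈ T} ≤ #(transversals π H R (X.erase (π y))) := by
            refine card_le_card_of_injOn (fun T => T.erase y) ?_ ?_
            · intro T hT
              rw [mem_coe, mem_filter, hC, mem_transversals] at hT
              obtain ⟨⟨hT1, hT2, hT3⟩, hyT⟩ := hT
              rw [mem_coe, mem_transversals]
              refine ⟨fun a ha b hb => hT1 a (mem_of_mem_erase ha) b (mem_of_mem_erase hb),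
                (erase_subset _ _).trans hT2, ?_⟩
              ext u
              simp only [mem_image, mem_erase]
              constructor
              · rintro ⟨a, ⟨hne, ha⟩, rfl⟩
                refine ⟨fun h => hT1 a ha y hyT (hclique a y hne h), ?_⟩
                rw [← hT3]
                exact mem_image_of_mem _ ha
              · rintro ⟨hne, hu⟩
                rw [← hT3, mem_image] at hu
                obtain ⟨a, ha, rfl⟩ := hu
                exact ⟨a, ⟨fun h => hne (h ▸ rfl), ha⟩, rfl⟩
            · intro T hT T' hT' h
              rw [mem_coe, mem_filter] at hT hT'
              rw [← insert_erase hT.2, ← insert_erase hT'.2]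
              exact congrArg (insert y) h
          have h5 : (#{T ∈ C | y ∈ T} : ℝ) ≤ #(transversals π H R (X.erase (π y))) := by
            exact_mod_cast h4
          calc _ ≤ (#(transversals π H R (X.erase (π y))) : ℝ) := h5
            _ = 2 / t * (t / 2 * #(transversals π H R (X.erase (π y)))) := by field_simp
            _ ≤ _ := by gcongr
        · have : {T ∈ C | y ∈ T} = ∅ := filter_eq_empty_iff.2 fun T hT hyT => hy (by
            rw [hC, mem_transversals] at hT
            rw [← hT.2.2]
            exact mem_image_of_mem _ hyT)
          rw [this, card_empty, Nat.cast_zero]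
          positivity
      have hst' : 4 * (s : ℝ) ≤ t := by exact_mod_cast hst
      calc (#{T ∈ C | ∃ y ∈ T, H.Adj x y} : ℝ)
          ≤ ∑ y ∈ R with H.Adj x y ∧ π y ≠ π x, (#{T ∈ C | y ∈ T} : ℝ) := by
            exact_mod_cast (card_le_card h1).trans card_biUnion_le
        _ ≤ ∑ y ∈ R with H.Adj x y ∧ π y ≠ π x, 2 / (t : ℝ) * #C := sum_le_sum fun y _ => h2 y
        _ ≤ s * (2 / (t : ℝ) * #C) := by
            rw [sum_const, nsmul_eq_mul]
            gcongr
            exact_mod_cast hs x hx.1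
        _ = 2 * s / t * #C := by ring
        _ ≤ 1 / 2 * #C := by
            refine mul_le_mul_of_nonneg_right ?_ (by positivity)
            rw [div_le_iff₀ ht0]
            linarith
        _ = _ := by ring
    have hext : ∑ x ∈ L, #{T ∈ C | ¬ ∃ y ∈ T, H.Adj x y} ≤ #(transversals π H R (insert v X)) := by
      rw [← card_sigma]
      refine card_le_card_of_injOn (fun p => insert p.1 p.2) ?_ ?_
      · rintro ⟨x, T⟩ hp
        rw [mem_coe, mem_sigma, mem_filter, mem_filter, hC, mem_transversals] at hp
        obtain ⟨⟨hxR, hxv⟩, ⟨hT1, hT2, hT3⟩, hxT⟩ := hp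
        push Not at hxT
        rw [mem_coe, mem_transversals]
        refine ⟨?_, insert_subset hxR hT2, by rw [image_insert, hT3, hxv]⟩
        intro a ha b hb
        rw [mem_insert] at ha hb
        rcases ha with rfl | ha <;> rcases hb with rfl | hb
        · exact H.loopless.irrefl _
        · exact hxT b hb
        · exact fun h => hxT a ha h.symm
        · exact hT1 a ha b hb
      · rintro ⟨x, T⟩ hp ⟨x', T'⟩ hp' h
        rw [mem_coe, mem_sigma, mem_filter, mem_filter] at hp hp'
        dsimp only at h hp hp'
        have hx : x ∉ T' := fun hx => hfib T' hp'.2.1 x hx hp.1.2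
        have hx' : x' ∉ T := fun hx => hfib T hp.2.1 x' hx hp'.1.2
        have hxx : x = x' := (mem_insert.1 (h ▸ mem_insert_self x T)).resolve_right hx
        subst hxx
        have hTT : T = T' := by
          rw [← erase_insert hx', ← erase_insert hx, h]
        rw [hTT]
    calc (t : ℝ) / 2 * #C ≤ #L * (#C / 2) := by
          have : (0 : ℝ) ≤ #C := by positivity
          nlinarith
      _ = ∑ x ∈ L, (#C : ℝ) / 2 := by rw [sum_const, nsmul_eq_mul]
      _ ≤ ∑ x ∈ L, (#{T ∈ C | ¬ ∃ y ∈ T, H.Adj x y} : ℝ) := by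
          refine sum_le_sum fun x hx => ?_
          have h1 := hconf x hx
          have h2 : (#{T ∈ C | ∃ y ∈ T, H.Adj x y} : ℝ) + #{T ∈ C | ¬ ∃ y ∈ T, H.Adj x y} = #C := by
            exact_mod_cast card_filter_add_card_filter_not _
          linarith
      _ ≤ _ := by exact_mod_cast hext

theorem transversals_nonempty {π : W → V} {H : SimpleGraph W} {R : Finset W} {s t : ℕ}
    (hclique : ∀ x y, x ≠ y → π x = π y → H.Adj x y) (hst : 4 * s ≤ t) (ht : 1 ≤ t)
    {U : Finset V} (hR : ∀ v ∈ U, t ≤ #{x ∈ R | π x = v})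
    (hs : ∀ x ∈ R, #{y ∈ R | H.Adj x y ∧ π y ≠ π x} ≤ s) :
    (transversals π H R U).Nonempty := by
  have key : ∀ X : Finset V, X ⊆ U → (0 : ℝ) < #(transversals π H R X) := by
    intro X
    induction X using Finset.induction_on with
    | empty =>
      intro _
      rw [Nat.cast_pos, card_pos]
      exact ⟨∅, mem_transversals.2 (by simp)⟩
    | insert v X hv ih =>
      intro hX
      have h1 := ih ((subset_insert _ _).trans hX)
      have h2 := card_transversals_insert hclique hst ht hR hs X v hv hX
      have : (0 : ℝ) < t := by exact_mod_cast ht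
      have : 0 < (t : ℝ) / 2 * #(transversals π H R X) := by positivity
      linarith
  have := key U Subset.rfl
  rw [Nat.cast_pos, card_pos] at this
  exact this

end Classical

/-! ### Flawless partial colourings -/

section Classical
open Classical Finset

variable {V W : Type*} [Fintype W] {G : SimpleGraph V} {π : W → V} {H : SimpleGraph W}

/-- The obstruction at `v` to completing a partial colouring `I`: fewer than `t` colours of `v` are
available, or one of them has at least `s` free neighbours. -/
def IsFlaw (π : W → V) (H : SimpleGraph W) (s t : ℕ) (v : V) (I : Finset W) : Prop :=
  #(avail π H v I) < t ∨
    ∃ x, π x = v ∧ Disjoint (outer π H x) I ∧ s ≤ #(freeIn H (outer π H x) I)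

theorem IsTriangleFreeCover.isFlaw_congr (hc : IsTriangleFreeCover G π H) {s t : ℕ} {w : V}
    {I J : Finset W} (h : ∀ y, G.Adj w (π y) ∨ (∃ z, G.Adj w z ∧ G.Adj z (π y)) →
      (y ∈ I ↔ y ∈ J)) : IsFlaw π H s t w I ↔ IsFlaw π H s t w J := by
  have h1 : ∀ x, π x = w → (Disjoint (outer π H x) I ↔ Disjoint (outer π H x) J) := by
    intro x hx
    simp only [disjoint_left]
    refine forall₂_congr fun y hy => not_congr (h y (Or.inl ?_))
    rw [mem_outer] at hy
    exact hx ▸ hc.adj x y hy.1 hy.2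
  have h2 : ∀ x, π x = w → freeIn H (outer π H x) I = freeIn H (outer π H x) J := by
    intro x hx
    refine filter_congr fun y hy => ?_
    rw [mem_outer] at hy
    have hwy : G.Adj w (π y) := hx ▸ hc.adj x y hy.1 hy.2
    have h3 : ∀ z, H.Adj y z → (z ∈ I ↔ z ∈ J) := by
      intro z hyz
      by_cases hzy : π z = π y
      · exact h z (Or.inl (hzy ▸ hwy))
      · exact h z (Or.inr ⟨π y, hwy, hc.adj y z hyz hzy⟩)
    exact ⟨fun h4 z hz hyz => h4 z ((h3 z hyz).2 hz) hyz,
      fun h4 z hz hyz => h4 z ((h3 z hyz).1 hz) hyz⟩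
  have h3 : avail π H w I = avail π H w J := filter_congr fun x _ => and_congr_right (h1 x)
  rw [IsFlaw, IsFlaw, h3]
  refine or_congr_right (exists_congr fun x => and_congr_right fun hx => ?_)
  rw [h1 x hx, h2 x hx]

/-- A flawless partial colouring extends to a full colouring. -/
theorem IsTriangleFreeCover.exists_of_forall_not_isFlaw [Fintype V]
    (hc : IsTriangleFreeCover G π H) {s t : ℕ} (hst : 4 * s ≤ t) (ht : 1 ≤ t) {I : Finset W}
    (hI : I ∈ indepSets H) (hflaw : ∀ v, ¬ IsFlaw π H s t v I) :
    ∃ T ∈ indepSets H, T.image π = univ := by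
  simp only [IsFlaw, not_or, not_lt, not_exists, not_and, not_le] at hflaw
  set U : Finset V := univ \ I.image π with hU
  set R : Finset W := {x | π x ∈ U ∧ Disjoint (outer π H x) I} with hR
  have hmemR : ∀ x, x ∈ R ↔ π x ∈ U ∧ Disjoint (outer π H x) I := by simp [hR]
  have hUI : ∀ x ∈ I, π x ∉ U := fun x hx h => (mem_sdiff.1 h).2 (mem_image_of_mem _ hx)
  have hRI : ∀ y ∈ R, ∀ z ∈ I, ¬ H.Adj y z := by
    intro y hy z hz hyz
    rw [hmemR] at hy
    refine disjoint_left.1 hy.2 (mem_outer.2 ⟨hyz, fun h => hUI z hz (h ▸ hy.1)⟩) hz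
  obtain ⟨T, hT⟩ := transversals_nonempty (R := R) (U := U) hc.clique hst ht
    (fun v hv => (hflaw v).1.trans (card_le_card fun x hx => by
      rw [mem_avail] at hx
      rw [mem_filter, hmemR]
      exact ⟨⟨hx.1 ▸ hv, hx.2⟩, hx.1⟩))
    (fun x hx => by
      refine le_trans (card_le_card fun y hy => ?_)
        ((hflaw (π x)).2 x rfl ((hmemR x).1 hx).2).le
      rw [mem_filter] at hy
      rw [freeIn, mem_filter, mem_outer]
      exact ⟨hy.2, hRI y hy.1⟩)
  rw [mem_transversals] at hT
  rw [mem_indepSets] at hI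
  refine ⟨I ∪ T, mem_indepSets.2 ?_, ?_⟩
  · intro x hx y hy
    rw [mem_union] at hx hy
    rcases hx with hx | hx <;> rcases hy with hy | hy
    · exact hI x hx y hy
    · exact fun h => hRI y (hT.2.1 hy) x hx h.symm
    · exact hRI x (hT.2.1 hx) y hy
    · exact hT.1 x hx y hy
  · rw [image_union, hT.2.2, hU]
    exact union_sdiff_of_subset (subset_univ _)

theorem IsTriangleFreeCover.mass_isFlaw_le [Fintype V] (hc : IsTriangleFreeCover G π H) {v : V}
    {d k s t : ℕ} (hd : #{u | G.Adj v u} ≤ d) (hk : #{x | π x = v} = k) (htk : 2 * t < k)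
    {lam : ℝ} (hl : 0 < lam)
    (hM : 4 * (t : ℝ) ≤ (k - 2 * t) * Real.exp (-((1 + lam) * d / (k - 2 * t))))
    {E : Finset W → Prop} (hE : IgnoresNeighbors G π v E) :
    ∑ I ∈ indepSets H with (IsFlaw π H s t v I ∧ E I), lam ^ #I ≤
      ((1 / 2) ^ t + k * ((1 + lam) ^ s)⁻¹) * ∑ I ∈ indepSets H with E I, lam ^ #I := by
  have h1 := hc.mass_card_avail_lt hd hk htk hl hM hE
  have h2 : ∑ x with π x = v, ∑ I ∈ indepSets H with
      (E I ∧ Disjoint (outer π H x) I ∧ s ≤ #(freeIn H (outer π H x) I)), lam ^ #I ≤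
      k * (((1 + lam) ^ s)⁻¹ * ∑ I ∈ indepSets H with E I, lam ^ #I) := by
    rw [← hk, ← nsmul_eq_mul]
    refine sum_le_card_nsmul _ _ _ fun x hx => ?_
    exact hc.mass_card_free_ge (mem_filter.1 hx).2 s hl hE
  rw [add_mul, mul_assoc]
  refine le_trans ?_ (add_le_add h1 h2)
  simp_rw [sum_filter (s := indepSets H)]
  rw [sum_comm, ← sum_add_distrib]
  refine sum_le_sum fun I _ => ?_
  have hw : 0 ≤ lam ^ #I := by positivity
  have hn : ∀ x, 0 ≤ if E I ∧ Disjoint (outer π H x) I ∧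
      s ≤ #(freeIn H (outer π H x) I) then lam ^ #I else 0 := fun x => by split_ifs <;> simp [hw]
  have hn' : 0 ≤ if E I ∧ #(avail π H v I) < t then lam ^ #I else 0 := by
    split_ifs <;> simp [hw]
  have hsum := sum_nonneg fun x (_ : x ∈ ({x | π x = v} : Finset W)) => hn x
  by_cases h : IsFlaw π H s t v I ∧ E I
  · rw [if_pos h]
    rcases h.1 with ha | ⟨x, hx, hx'⟩
    · rw [if_pos ⟨h.2, ha⟩]
      linarith
    · have h3 := single_le_sum (fun x _ => hn x)
        (mem_filter.2 ⟨mem_univ x, hx⟩ : x ∈ ({x | π x = v} : Finset W))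
      rw [if_pos ⟨h.2, hx'⟩] at h3
      linarith
  · rw [if_neg h]
    exact add_nonneg hn' hsum

/-- The local lemma applied to the hard-core model with fugacity `lam`, followed by the completion
of the partial colouring. The size `d ^ 2 + d ^ 3` bounds the number of vertices at which a flaw
depends on the colours of the neighbours of a given vertex. -/
theorem IsTriangleFreeCover.exists_indepSet [Fintype V] (hc : IsTriangleFreeCover G π H)
    {d k s t : ℕ} (hd₁ : 1 ≤ d) (hd : ∀ v, #{u | G.Adj v u} ≤ d) (hk : ∀ v, #{x | π x = v} = k)
    (hst : 4 * s ≤ t) (ht : 1 ≤ t) (htk : 2 * t < k) {lam : ℝ} (hl : 0 < lam)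
    (hM : 4 * (t : ℝ) ≤ (k - 2 * t) * Real.exp (-((1 + lam) * d / (k - 2 * t))))
    (hq : 4 * ((1 / 2) ^ t + k * ((1 + lam) ^ s)⁻¹) * ((d : ℝ) ^ 2 + d ^ 3) ≤ 1) :
    ∃ T ∈ indepSets H, T.image π = univ := by
  let nb : V → Finset V := fun v => {u | G.Adj v u}
  have hnb : ∀ v u, u ∈ nb v ↔ G.Adj v u := by simp [nb]
  let nb₂ : V → Finset V := fun v => (nb v).biUnion nb
  let Γ : V → Finset V := fun v => nb₂ v ∪ (nb₂ v).biUnion nb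
  have hnb₂ : ∀ v, #(nb₂ v) ≤ d * d := fun v =>
    (card_biUnion_le_card_mul _ _ d fun u _ => hd u).trans (Nat.mul_le_mul_right _ (hd v))
  have hΓ : ∀ v, #(Γ v) ≤ d ^ 2 + d ^ 3 := fun v => by
    have h1 : #((nb₂ v).biUnion nb) ≤ #(nb₂ v) * d := card_biUnion_le_card_mul _ _ d fun u _ => hd u
    have h2 := hnb₂ v
    have h3 : #(nb₂ v) * d ≤ d * d * d := Nat.mul_le_mul_right _ h2
    have h4 : #(Γ v) ≤ #(nb₂ v) + #((nb₂ v).biUnion nb) := card_union_le _ _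
    calc _ ≤ d * d + d * d * d := by omega
      _ = _ := by ring
  -- A flaw at `w` depends on the colours within distance two of `w` only.
  have hign : ∀ v w, w ∉ Γ v → IgnoresNeighbors G π v (IsFlaw π H s t w) := by
    intro v w hw I J hIJ
    refine hc.isFlaw_congr fun y hy => hIJ y fun hvy => hw ?_
    simp only [Γ, nb₂, mem_union, mem_biUnion, hnb]
    rcases hy with hy | ⟨z, hwz, hzy⟩
    · exact Or.inl ⟨π y, hvy, hy.symm⟩
    · exact Or.inr ⟨z, ⟨π y, hvy, hzy.symm⟩, hwz.symm⟩
  have hlocal : ∀ v, ∀ S : Finset V, Disjoint S (Γ v) →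
      ∑ I ∈ indepSets H with (IsFlaw π H s t v I ∧ ∀ w ∈ S, ¬ IsFlaw π H s t w I), lam ^ #I ≤
        ((1 / 2) ^ t + k * ((1 + lam) ^ s)⁻¹) *
          ∑ I ∈ indepSets H with (∀ w ∈ S, ¬ IsFlaw π H s t w I), lam ^ #I := by
    intro v S hS
    have hE : IgnoresNeighbors G π v fun I => ∀ w ∈ S, ¬ IsFlaw π H s t w I :=
      fun I J hIJ => forall₂_congr fun w hw =>
        not_congr (hign v w (disjoint_left.1 hS hw) I J hIJ)
    convert hc.mass_isFlaw_le (hd v) (hk v) htk hl hM hE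
  obtain ⟨I, hI, hflaw⟩ := exists_forall_not_of_lopsided (indepSets H) (fun I => lam ^ #I)
    (fun I _ => by positivity)
    (sum_pos (fun I _ => by positivity) ⟨∅, mem_indepSets.2 (by simp)⟩)
    (IsFlaw π H s t) Γ ((1 / 2) ^ t + k * ((1 + lam) ^ s)⁻¹) (d ^ 2 + d ^ 3)
    (by have := Nat.one_le_pow 2 d hd₁; omega) (by exact_mod_cast hq) (by positivity) hΓ hlocal
  exact hc.exists_of_forall_not_isFlaw hst ht hI hflaw

end Classical

/-! ### Choice of the parameters -/

theorem four_mul_le_one_of_pow_le {ε d k : ℝ} {s : ℕ} (hε₀ : 0 < ε) (hε₁ : ε ≤ 1)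
    (hd : 6 ≤ d) (hk : k ≤ 3 * d) (h6 : d ^ 6 ≤ (1 + ε) ^ s) :
    4 * ((1 / 2) ^ (4 * s) + k * ((1 + ε) ^ s)⁻¹) * (d ^ 2 + d ^ 3) ≤ 1 := by
  have hd0 : 0 < d := by linarith
  have h7 : ((1 + ε) ^ s)⁻¹ ≤ (d ^ 6)⁻¹ := inv_anti₀ (by positivity) h6
  have h8 : (1 / 2 : ℝ) ^ (4 * s) ≤ (d ^ 6)⁻¹ := by
    refine le_trans ?_ h7
    rw [one_div, inv_pow]
    refine inv_anti₀ (by positivity) ?_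
    calc (1 + ε) ^ s ≤ 2 ^ s := by gcongr; linarith
      _ ≤ 2 ^ (4 * s) := pow_le_pow_right₀ one_le_two (by omega)
  have h9 : k * ((1 + ε) ^ s)⁻¹ ≤ 3 * d * (d ^ 6)⁻¹ :=
    mul_le_mul hk h7 (by positivity) (by positivity)
  have h10 := mul_le_mul_of_nonneg_left (add_le_add h8 h9) (zero_le_four (α := ℝ))
  refine (mul_le_mul_of_nonneg_right h10 (by positivity)).trans ?_
  have e1 : 4 * (1 + 3 * d) ≤ 16 * d := by linarith
  have e2 : d ^ 2 + d ^ 3 ≤ 2 * d ^ 3 := by nlinarith [sq_nonneg d]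
  have e3 : (32 : ℝ) ≤ d ^ 2 := by nlinarith
  calc _ = 4 * (1 + 3 * d) * (d ^ 2 + d ^ 3) / d ^ 6 := by ring
    _ ≤ 16 * d * (2 * d ^ 3) / d ^ 6 := by gcongr
    _ = 32 * d ^ 4 / d ^ 6 := by ring
    _ ≤ d ^ 2 * d ^ 4 / d ^ 6 := by gcongr
    _ = 1 := by field_simp

/-- The numerical conditions needed for a graph of maximum degree `d`, fulfilled by `lam = ε`,
lists of logarithmic size `t` and conflicts of logarithmic number `s`. -/
theorem exists_parameters (ε : ℝ) (hε₀ : 0 < ε) (hε₁ : ε < 1 / 3) :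
    ∃ D : ℕ, ∀ d : ℕ, D ≤ d → ∃ s t : ℕ, 1 ≤ d ∧ 4 * s ≤ t ∧ 1 ≤ t ∧
      2 * t < ⌊(1 + 4 * ε) * (d : ℝ) / Real.log d⌋₊ ∧
      4 * (t : ℝ) ≤ (⌊(1 + 4 * ε) * (d : ℝ) / Real.log d⌋₊ - 2 * t) *
        Real.exp (-((1 + ε) * d / (⌊(1 + 4 * ε) * (d : ℝ) / Real.log d⌋₊ - 2 * t))) ∧
      4 * ((1 / 2) ^ t + ⌊(1 + 4 * ε) * (d : ℝ) / Real.log d⌋₊ * ((1 + ε) ^ s)⁻¹) *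
        ((d : ℝ) ^ 2 + d ^ 3) ≤ 1 := by
  have hlog : 0 < Real.log (1 + ε) := Real.log_pos (by linarith)
  set C : ℝ := 6 / Real.log (1 + ε) with hC
  have hC0 : 0 < C := by positivity
  set M : ℝ := 2 + 96 * (C + 1) / ε ^ 3 + 6 * (9 + 8 * C) / ε with hM
  refine ⟨⌈Real.exp M⌉₊, fun d hd => ?_⟩
  have hd1 : Real.exp M ≤ d := Nat.ceil_le.1 hd
  have hd0 : (0 : ℝ) < d := (Real.exp_pos M).trans_le hd1
  set L : ℝ := Real.log d with hL
  have hML : M ≤ L := (Real.le_log_iff_exp_le hd0).2 hd1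
  have hexp : Real.exp L = d := Real.exp_log hd0
  have hp1 : 0 < 96 * (C + 1) / ε ^ 3 := by positivity
  have hp2 : 0 < 6 * (9 + 8 * C) / ε := by positivity
  have hL1 : 2 ≤ L := by linarith
  have hL0 : 0 < L := by linarith
  have hLA : 96 * (C + 1) ≤ ε ^ 3 * L := by
    have : 96 * (C + 1) / ε ^ 3 ≤ L := by linarith
    rw [div_le_iff₀ (by positivity)] at this
    linarith
  have hLB : 6 * (9 + 8 * C) ≤ ε * L := by
    have : 6 * (9 + 8 * C) / ε ≤ L := by linarith
    rw [div_le_iff₀ (by positivity)] at this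
    linarith
  have hcube : ∀ x : ℝ, 0 ≤ x → x ^ 3 / 6 ≤ Real.exp x := fun x hx => by
    have := Real.pow_div_factorial_le_exp x hx 3
    simpa [Nat.factorial] using this
  have hA : 16 * (C * L + 1) * L ≤ Real.exp (ε * L) := by
    refine le_trans ?_ (hcube (ε * L) (by positivity))
    have h1 : 96 * (C + 1) * L ^ 2 ≤ ε ^ 3 * L * L ^ 2 := by gcongr
    nlinarith
  have hB : 1 + 8 * (C * L + 1) ≤ ε * d / L := by
    rw [le_div_iff₀ hL0, ← hexp]
    have h0 := mul_le_mul_of_nonneg_left (hcube L hL0.le) hε₀.le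
    refine le_trans ?_ h0
    have h1 : 6 * (9 + 8 * C) * L ^ 2 ≤ ε * L * L ^ 2 := by gcongr
    nlinarith
  set k : ℕ := ⌊(1 + 4 * ε) * (d : ℝ) / L⌋₊ with hk
  set s : ℕ := ⌈C * L⌉₊ with hs
  have hs1 : C * L ≤ s := Nat.le_ceil _
  have hs2 : (s : ℝ) ≤ C * L + 1 := (Nat.ceil_lt_add_one (by positivity)).le
  have hs0 : 0 < s := Nat.ceil_pos.2 (by positivity)
  have hk1 : (1 + 4 * ε) * (d : ℝ) / L - 1 ≤ k := (Nat.sub_one_lt_floor _).le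
  have hk2 : (k : ℝ) ≤ (1 + 4 * ε) * d / L := Nat.floor_le (by positivity)
  have hk3 : (k : ℝ) ≤ 3 * d := by
    refine hk2.trans ?_
    rw [div_le_iff₀ hL0]
    nlinarith
  have hkt : (1 + 3 * ε) * d / L ≤ k - 2 * ((4 * s : ℕ) : ℝ) := by
    push_cast
    have : (1 + 4 * ε) * (d : ℝ) / L = (1 + 3 * ε) * d / L + ε * d / L := by ring
    linarith
  have hpos : 0 < (1 + 3 * ε) * d / L := by positivity
  have hkt0 : (0 : ℝ) < k - 2 * ((4 * s : ℕ) : ℝ) := hpos.trans_le hkt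
  clear_value k s L
  refine ⟨s, 4 * s, by exact_mod_cast hd0, le_rfl, by omega, ?_, ?_, ?_⟩
  · have : 2 * ((4 * s : ℕ) : ℝ) < k := by linarith
    exact_mod_cast this
  · have h1 : (1 + ε) * d / (k - 2 * ((4 * s : ℕ) : ℝ)) ≤ (1 - ε) * L := by
      calc _ ≤ (1 + ε) * d / ((1 + 3 * ε) * d / L) := by gcongr
        _ = (1 + ε) / (1 + 3 * ε) * L := by field_simp
        _ ≤ (1 - ε) * L := by
          refine mul_le_mul_of_nonneg_right ?_ hL0.le
          -- `(1 - ε) * (1 + 3 * ε) - (1 + ε) = ε * (1 - 3 * ε)`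
          rw [div_le_iff₀ (by positivity)]
          nlinarith
    calc 4 * ((4 * s : ℕ) : ℝ) ≤ 16 * (C * L + 1) := by push_cast; linarith
      _ ≤ Real.exp (ε * L) / L := by rw [le_div_iff₀ hL0]; exact hA
      _ = d / L * Real.exp (-((1 - ε) * L)) := by
          have : -((1 - ε) * L) = ε * L - L := by ring
          rw [this, Real.exp_sub, hexp]
          field_simp
      _ ≤ (1 + 3 * ε) * d / L * Real.exp (-((1 - ε) * L)) := by
          gcongr
          nlinarith
      _ ≤ _ := by gcongr
  · have h6 : (d : ℝ) ^ 6 ≤ (1 + ε) ^ s := by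
      have h1 : 6 * L ≤ s * Real.log (1 + ε) := by
        have : C * L * Real.log (1 + ε) = 6 * L := by rw [hC]; field_simp
        nlinarith
      calc (d : ℝ) ^ 6 = Real.exp (6 * L) := by
            rw [← hexp, ← Real.exp_nat_mul]; norm_num
        _ ≤ Real.exp (s * Real.log (1 + ε)) := Real.exp_le_exp.2 h1
        _ = _ := by rw [Real.exp_nat_mul, Real.exp_log (by linarith)]
    have hd6 : (6 : ℝ) ≤ d := by
      rw [← hexp]
      have h1 : Real.exp 1 ^ 2 ≤ Real.exp L := by
        rw [← Real.exp_nat_mul]; exact Real.exp_le_exp.2 (by push_cast; linarith)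
      nlinarith [Real.exp_one_gt_d9]
    exact four_mul_le_one_of_pow_le hε₀ (by linarith) hd6 hk3 h6

/-! ### Colouring a triangle-free cover -/

section Classical
open Classical Finset

/-- A restriction of a triangle-free cover to sublists of size `m` is a triangle-free cover; the
colours of `v` kept form the set `S v`. -/
theorem DPCover.TriangleFree.restrict {V : Type*} {G : SimpleGraph V} {n : ℕ}
    {C : DPCover G n} (hC : C.TriangleFree) (S : ∀ v, Finset (C.L v)) :
    IsTriangleFreeCover G (Sigma.fst : (Σ v : V, S v) → V)
      (C.H.comap fun x => (⟨x.1, x.2.1⟩ : Σ v : V, C.L v)) where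
  clique := by
    rintro ⟨v, c⟩ ⟨w, c'⟩ hne (rfl : v = w)
    refine C.complete _ _ rfl fun h => hne ?_
    exact congrArg (Sigma.mk v) (Subtype.ext (eq_of_heq (Sigma.mk.inj_iff.1 h).2))
  adj := by
    intro x y hxy hne
    by_contra h
    exact C.no_edge x.1 y.1 hne.symm h _ _ rfl rfl hxy
  indep := by
    intro x y z hxy hyx hxz hzx hyz
    rw [SimpleGraph.comap_adj] at hxy hxz hyz
    have hG : G.Adj x.1 y.1 := by
      by_contra h
      exact C.no_edge x.1 y.1 hyx.symm h _ _ rfl rfl hxy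
    by_cases h : y.1 = z.1
    · exact hyz.ne (C.matching x.1 y.1 hG _ _ _ rfl rfl h.symm hxy hxz)
    · exact hC _ (SimpleGraph.is3Clique_triple_iff.2
        ⟨⟨hxy, hyx.symm⟩, ⟨hxz, hzx.symm⟩, ⟨hyz, h⟩⟩)

theorem DPCover.TriangleFree.colourable {V : Type*} [Fintype V] {G : SimpleGraph V} {n : ℕ}
    {C : DPCover G n} (hC : C.TriangleFree) {d k s t : ℕ} (hkn : k ≤ n) (hd₁ : 1 ≤ d)
    (hd : ∀ v, #{u | G.Adj v u} ≤ d) (hst : 4 * s ≤ t) (ht : 1 ≤ t) (htk : 2 * t < k)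
    {lam : ℝ} (hl : 0 < lam)
    (hM : 4 * (t : ℝ) ≤ (k - 2 * t) * Real.exp (-((1 + lam) * d / (k - 2 * t))))
    (hq : 4 * ((1 / 2) ^ t + k * ((1 + lam) ^ s)⁻¹) * ((d : ℝ) ^ 2 + d ^ 3) ≤ 1) :
    C.Colourable := by
  have hS : ∀ v, ∃ S : Finset (C.L v), #S = k := fun v => by
    obtain ⟨S, -, hS⟩ := exists_subset_card_eq (s := (univ : Finset (C.L v))) (n := k)
      (by rw [card_univ, Fintype.card_coe, C.card_L]; exact hkn)
    exact ⟨S, hS⟩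
  choose S hS using hS
  have hfib : ∀ v, #{x : Σ v : V, S v | x.1 = v} = k := by
    intro v
    have : ({x : Σ v : V, S v | x.1 = v} : Finset _) =
        (univ : Finset (S v)).map (Function.Embedding.sigmaMk v) := by
      ext ⟨w, c⟩
      simp only [mem_filter, mem_univ, true_and, mem_map, Function.Embedding.sigmaMk_apply]
      constructor
      · rintro rfl
        exact ⟨c, rfl⟩
      · rintro ⟨c', h⟩
        exact (congrArg Sigma.fst h).symm
    rw [this, card_map, card_univ, Fintype.card_coe, hS]
  have hc := hC.restrict S
  obtain ⟨T, hT, hTV⟩ := hc.exists_indepSet hd₁ hd hfib hst ht htk hl hM hq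
  let f : (Σ v : V, S v) → Σ v : V, C.L v := fun x => ⟨x.1, x.2.1⟩
  have hf : Set.InjOn f T := fun x hx y hy h => 
    hc.injOn hT hx hy (congrArg Sigma.fst h : (f x).1 = (f y).1)
  refine ⟨T.image f, ?_, ?_⟩
  · intro x hx y hy _ hxy
    rw [mem_coe, mem_image] at hx hy
    obtain ⟨x, hx, rfl⟩ := hx
    obtain ⟨y, hy, rfl⟩ := hy
    exact mem_indepSets.1 hT x hx y hy hxy
  · rw [card_image_of_injOn hf, ← card_image_of_injOn (hc.injOn hT), hTV, card_univ]

end Classical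

theorem theorem5 (ε : ℝ) (hε₀ : 0 < ε) (hε₁ : ε < 1 / 3) :
    ∃ Δε : ℕ, ∀ (V : Type*) [Fintype V] (G : SimpleGraph V) [DecidableRel G.Adj],
      Δε ≤ G.maxDegree →
      ∀ n : ℕ, ⌊(1 + 4 * ε) * (G.maxDegree : ℝ) / Real.log (G.maxDegree : ℝ)⌋₊ ≤ n →
      ∀ C : DPCover G n, C.TriangleFree → C.Colourable := by
  obtain ⟨D, hD⟩ := exists_parameters ε hε₀ hε₁
  refine ⟨D, fun V _ G _ hG n hn C hC => ?_⟩
  obtain ⟨s, t, hd₁, hst, ht, htk, hM, hq⟩ := hD _ hG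
  refine hC.colourable hn hd₁ (fun v => ?_) hst ht htk hε₀ hM hq
  have h := G.degree_le_maxDegree v
  rw [← SimpleGraph.card_neighborFinset_eq_degree, SimpleGraph.neighborFinset_eq_filter] at h
  convert h
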